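/- Let $\Psi:\mathbb R^p\times\mathbb R^q\to\mathbb R^q$ be such that $\Psi(z,\theta)$ is measurable in $z$ and continuously differentiable in $\theta$, with derivative matrix $\dot\Psi(z,\theta)=\big(\partial\Psi_j(z,\theta)/\partial\theta_k\big)_{j,k}$. Let $T$ be an M functional with score $\Psi$: a map from a set $\mathcal G$ of probability distributions on $\mathbb R^p$ to $\mathbb R^q$ such that, for every $G\in\mathcal G$, the expectation $\mathrm E_G\Psi(z,T(G))$ exists and equals $0$. Let $G_0\in\mathcal G$, let $\theta_0=T(G_0)$, and assume that $T$ is continuous at $G_0$ with respect to weak convergence of distributions in $\mathcal G$, that $$\mathrm E_{G_0}\sup_{\|\theta-\theta_0\|\le\eta}\|\dot\Psi(z,\theta)\|<\infty\quad\text{for some }\eta>0,$$ and that the matrix $D_0=\mathrm E_{G_0}\dot\Psi(z,\theta_0)$ is nonsingular. Suppose that, for $G_0$-almost every $z$, $(1-\varepsilon)G_0+\varepsilon\delta_z\in\mathcal G$ for all sufficiently small $\varepsilon>0$. Then the influence function $$I_{T,G_0}(z)=\frac{\partial}{\partial\varepsilon}T\big((1-\varepsilon)G_0+\varepsilon\delta_z\big)\Big|_{\varepsilon=0^+}$$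 exists at every $z$ with this property. Assume moreover that $I_{T,G_0}(z)$ has finite second moments under $G_0$. Let $z_1,z_2,\dots$ be i.i.d. with distribution $G_0$, let $G_n$ be the empirical distribution of $z_1,\dots,z_n$, and suppose that almost surely $G_n\in\mathcal G$ for all sufficiently large $n$ (with $T(G_n)$ a random vector). Then $$\sqrt n\,\big(T(G_n)-T(G_0)\big)\ \xrightarrow{d}\ N(0,V),\qquad V=\mathrm E_{G_0}\,I_{T,G_0}(z)\,I_{T,G_0}(z)'.$$ -/

import Mathlib

open MeasureTheory ProbabilityTheory Filter Topology
open scoped ENNReal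

namespace MFunctional

noncomputable section

/-- The empirical distribution `(n + 1)⁻¹ ∑_{i ≤ n} δ_{z i}` of the `n + 1` observations
`z 0, …, z n`; the sample size is `n + 1`, so that this is a probability measure for every `n`. -/
def empiricalDistribution {p : ℕ} (n : ℕ) (z : ℕ → EuclideanSpace ℝ (Fin p)) :
    ProbabilityMeasure (EuclideanSpace ℝ (Fin p)) :=
  ⟨((n + 1 : ℕ) : ℝ≥0∞)⁻¹ • ∑ i ∈ Finset.range (n + 1), Measure.dirac (z i), ⟨by
    simp only [Measure.smul_apply, Measure.finsetSum_apply, measure_univ, Finset.sum_const,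
      Finset.card_range, nsmul_eq_mul, mul_one, smul_eq_mul]
    exact ENNReal.inv_mul_cancel (by simp) (by simp)⟩⟩

/-- The contaminated distribution `(1 - ε) G + ε δ_z`, for `ε ∈ [0, 1]`. -/
def contaminate {p : ℕ} (G : ProbabilityMeasure (EuclideanSpace ℝ (Fin p)))
    (z : EuclideanSpace ℝ (Fin p)) (ε : Set.Icc (0 : ℝ) 1) :
    ProbabilityMeasure (EuclideanSpace ℝ (Fin p)) :=
  ⟨ENNReal.ofReal (1 - ε) • (G : Measure (EuclideanSpace ℝ (Fin p))) +
      ENNReal.ofReal ε • Measure.dirac z, ⟨by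
    simp only [Measure.add_apply, Measure.smul_apply, measure_univ, smul_eq_mul, mul_one]
    rw [← ENNReal.ofReal_add (sub_nonneg.2 ε.2.2) ε.2.1]
    simp⟩⟩

/-- The path `ε ↦ (1 - ε) G + ε δ_z`, as a function on `ℝ` which is constant outside of `[0, 1]`. -/
def contaminationPath {p : ℕ} (G : ProbabilityMeasure (EuclideanSpace ℝ (Fin p)))
    (z : EuclideanSpace ℝ (Fin p)) (ε : ℝ) :
    ProbabilityMeasure (EuclideanSpace ℝ (Fin p)) :=
  contaminate G z (Set.projIcc 0 1 zero_le_one ε)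

/-- Hampel's influence function `I_{T,G}(z)`: the (one-sided) derivative of
`ε ↦ T ((1 - ε) G + ε δ_z)` at `ε = 0`. -/
def influenceFunction {p q : ℕ}
    (T : ProbabilityMeasure (EuclideanSpace ℝ (Fin p)) → EuclideanSpace ℝ (Fin q))
    (G : ProbabilityMeasure (EuclideanSpace ℝ (Fin p))) (z : EuclideanSpace ℝ (Fin p)) :
    EuclideanSpace ℝ (Fin q) :=
  derivWithin (fun ε : ℝ => T (contaminationPath G z ε)) (Set.Icc 0 1) 0

/-- `T`, with domain of definition `dom`, is the M functional with score function `Ψ`: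
`E_G Ψ(z, T(G))` exists and is `0` for every `G` in the domain. Values of `T` off `dom` carry no
meaning. -/
structure IsMFunctional {p q : ℕ}
    (Ψ : EuclideanSpace ℝ (Fin p) → EuclideanSpace ℝ (Fin q) → EuclideanSpace ℝ (Fin q))
    (dom : Set (ProbabilityMeasure (EuclideanSpace ℝ (Fin p))))
    (T : ProbabilityMeasure (EuclideanSpace ℝ (Fin p)) → EuclideanSpace ℝ (Fin q)) : Prop where
  integrable : ∀ G ∈ dom,
    Integrable (fun z => Ψ z (T G)) (G : Measure (EuclideanSpace ℝ (Fin p)))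
  integral_eq_zero : ∀ G ∈ dom,
    ∫ z, Ψ z (T G) ∂(G : Measure (EuclideanSpace ℝ (Fin p))) = 0

/-- `Ψ̇(z, θ)`, the derivative of `Ψ(z, θ)` with respect to `θ`, as a linear map (its matrix in the
standard basis is the `q × q` matrix with the entries `∂Ψ_j(z, θ) / ∂θ_k`). -/
def psiDot {p q : ℕ}
    (Ψ : EuclideanSpace ℝ (Fin p) → EuclideanSpace ℝ (Fin q) → EuclideanSpace ℝ (Fin q))
    (z : EuclideanSpace ℝ (Fin p)) (θ : EuclideanSpace ℝ (Fin q)) :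
    EuclideanSpace ℝ (Fin q) →L[ℝ] EuclideanSpace ℝ (Fin q) :=
  fderiv ℝ (Ψ z) θ

/-- `D(G, θ) = E_G Ψ̇(z, θ)`. -/
def meanPsiDot {p q : ℕ}
    (Ψ : EuclideanSpace ℝ (Fin p) → EuclideanSpace ℝ (Fin q) → EuclideanSpace ℝ (Fin q))
    (G : ProbabilityMeasure (EuclideanSpace ℝ (Fin p))) (θ : EuclideanSpace ℝ (Fin q)) :
    EuclideanSpace ℝ (Fin q) →L[ℝ] EuclideanSpace ℝ (Fin q) :=
  ∫ z, psiDot Ψ z θ ∂(G : Measure (EuclideanSpace ℝ (Fin p)))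

/-- The second moment matrix `E_G I_{T,G}(z) I_{T,G}(z)'`. -/
def asymptoticCovariance {p q : ℕ}
    (T : ProbabilityMeasure (EuclideanSpace ℝ (Fin p)) → EuclideanSpace ℝ (Fin q))
    (G : ProbabilityMeasure (EuclideanSpace ℝ (Fin p))) : Matrix (Fin q) (Fin q) ℝ :=
  Matrix.of fun j k =>
    ∫ z, influenceFunction T G z j * influenceFunction T G z k
      ∂(G : Measure (EuclideanSpace ℝ (Fin p)))

end

end MFunctional

/-! Put `L θ = E Ψ(z, θ)` under `G₀`, with zero `θ₀ = T G₀`. The integrable envelope of `Ψ̇` permits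
differentiation under the integral, so `L` has the invertible derivative `D = E Ψ̇(z, θ₀)` at `θ₀`.
Along a contaminated path, `(1 - ε) L(θ_ε) + ε Ψ(z, θ_ε) = 0`, and continuity of `T` gives `θ_ε →
θ₀`. Implicit differentiation (`hasDerivWithinAt_of_isZero_mixture`) yields the influence function
`-D⁻¹ Ψ(z, θ₀)`. It is therefore centred, and its second moment matrix is a covariance matrix.

For the sample, Varadarajan's theorem and continuity of `T` give strong consistency of `θ_n = T
G_n`. Expanding `∑ Ψ(z_i, θ_n) = 0` at `θ₀` leaves an error at most `‖θ_n - θ₀‖` times the mean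
oscillation of `Ψ̇` on a small ball. By the strong law and dominated convergence this oscillation
can be made arbitrarily small. Hence, almost surely, `θ_n - θ₀` is asymptotically equivalent to the
mean of the influence values (`ae_isEquivalent_estimator`). The error is relative, so no prior rate
for `θ_n` is needed; the central limit theorem and a Slutsky argument conclude. -/

namespace MFunctional

/-! ### Limit theorems: multivariate CLT, Slutsky, Varadarajan. -/

/-- The quadratic form of the second moment matrix of a square integrable random vector. -/
theorem dotProduct_secondMoment_mulVec {Ω : Type*} [MeasurableSpace Ω] {μ : Measure Ω} {q : ℕ}
    {Y : Ω → EuclideanSpace ℝ (Fin q)} (hY : MemLp Y 2 μ) (x : Fin q → ℝ) :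
    x ⬝ᵥ (Matrix.of fun j k => ∫ ω, Y ω j * Y ω k ∂μ).mulVec x =
      ∫ ω, (∑ j, Y ω j * x j) ^ 2 ∂μ := by
  have hc : ∀ j, MemLp (fun ω => Y ω j) 2 μ := fun j =>
    (EuclideanSpace.proj (𝕜 := ℝ) j).comp_memLp' hY
  have hint : ∀ j k, Integrable (fun ω => Y ω j * Y ω k) μ := fun j k =>
    (hc j).integrable_mul (hc k)
  have h : ∀ ω, (∑ j, Y ω j * x j) ^ 2 = ∑ j, ∑ k, x j * x k * (Y ω j * Y ω k) := by
    intro ω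
    rw [sq, Finset.sum_mul_sum]
    exact Finset.sum_congr rfl fun j _ => Finset.sum_congr rfl fun k _ => by ring
  simp_rw [h]
  rw [integral_finsetSum _ fun j _ => integrable_finsetSum _ fun k _ => (hint j k).const_mul _]
  simp only [dotProduct, Matrix.mulVec, Matrix.of_apply]
  refine Finset.sum_congr rfl fun j _ => ?_
  rw [integral_finsetSum _ fun k _ => (hint j k).const_mul _, Finset.mul_sum]
  refine Finset.sum_congr rfl fun k _ => ?_
  rw [integral_const_mul]
  ring

theorem posSemidef_secondMoment {Ω : Type*} [MeasurableSpace Ω] {μ : Measure Ω} {q : ℕ}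
    {Y : Ω → EuclideanSpace ℝ (Fin q)} (hY : MemLp Y 2 μ) :
    (Matrix.of fun j k => ∫ ω, Y ω j * Y ω k ∂μ).PosSemidef := by
  refine .of_dotProduct_mulVec_nonneg ?_ fun x => ?_
  · ext j k
    simp [Matrix.conjTranspose_apply, mul_comm]
  · rw [star_trivial, dotProduct_secondMoment_mulVec hY]
    exact integral_nonneg fun ω => sq_nonneg _

/-- The **multivariate central limit theorem** for centered square integrable vectors. -/
theorem tendstoInDistribution_inv_sqrt_smul_sum {Ω : Type*} [MeasurableSpace Ω] {P : Measure Ω}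
    [IsProbabilityMeasure P] {q : ℕ} {X : ℕ → Ω → EuclideanSpace ℝ (Fin q)}
    (hX : MemLp (X 0) 2 P) (h0 : ∫ ω, X 0 ω ∂P = 0) (hindep : iIndepFun X P)
    (hident : ∀ i, IdentDistrib (X i) (X 0) P P) :
    TendstoInDistribution
      (fun (n : ℕ) ω => (√((n + 1 : ℕ) : ℝ))⁻¹ • ∑ k ∈ Finset.range (n + 1), X k ω) atTop id
      (fun _ => P)
      (multivariateGaussian 0 (Matrix.of fun j k => ∫ ω, X 0 ω j * X 0 ω k ∂P)) where
  forall_aemeasurable n :=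
    AEMeasurable.fun_const_smul (g := fun ω => ∑ k ∈ Finset.range (n + 1), X k ω)
      (Finset.aemeasurable_fun_sum _ fun _ _ => (hident _).aemeasurable_fst) _
  tendsto := by
    have hsum : ∀ n : ℕ, AEMeasurable
        (fun ω => (√((n + 1 : ℕ) : ℝ))⁻¹ • ∑ k ∈ Finset.range (n + 1), X k ω) P := fun n =>
      AEMeasurable.fun_const_smul (g := fun ω => ∑ k ∈ Finset.range (n + 1), X k ω)
      (Finset.aemeasurable_fun_sum _ fun _ _ => (hident _).aemeasurable_fst) _
    refine ProbabilityMeasure.tendsto_iff_tendsto_charFun.2 fun t => ?_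
    simp only [ProbabilityMeasure.coe_mk, Measure.map_id]
    -- Cramér–Wold: the characteristic function of the vector sum at `t` is that of the scalar sum
    -- of the projections `W` at `1`, so the one-dimensional theorem suffices.
    let W : ℕ → Ω → ℝ := fun i ω => inner ℝ (X i ω) t
    have hW : MemLp (W 0) 2 P := hX.inner_const t
    have hWmean : ∫ ω, W 0 ω ∂P = 0 := by
      have := integral_inner (𝕜 := ℝ) (hX.integrable one_le_two) t
      simp only [h0, inner_zero_right] at this
      rw [← this]
      exact integral_congr_ae (.of_forall fun ω => real_inner_comm _ _)
    have hWvar : Var[W 0; P] =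
        t.ofLp ⬝ᵥ (Matrix.of fun j k => ∫ ω, X 0 ω j * X 0 ω k ∂P).mulVec t.ofLp := by
      rw [variance_of_integral_eq_zero hW.aemeasurable hWmean, dotProduct_secondMoment_mulVec hX]
      refine integral_congr_ae (.of_forall fun ω => ?_)
      simp [W, PiLp.inner_apply, mul_comm]
    have key := tendstoInDistribution_inv_sqrt_mul_sum_sub (P := P) (X := W)
      (P' := gaussianReal 0 Var[W 0; P].toNNReal) (Y := id) HasLaw.id hW
      (hindep.comp (fun _ x => inner ℝ x t) fun _ => by fun_prop)
      fun i => (hident i).comp (u := fun x => inner ℝ x t) (by fun_prop)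
    -- The shift matches sample size `n + 1` to index `n`.
    have key' := (ProbabilityMeasure.tendsto_iff_tendsto_charFun.1 key.tendsto 1).comp
      (tendsto_add_atTop_nat 1)
    simp only [ProbabilityMeasure.coe_mk, Measure.map_id, charFun_gaussianReal] at key'
    rw [charFun_multivariateGaussian (posSemidef_secondMoment hX)]
    convert key' using 2 with n
    · rw [Function.comp_apply, charFun_apply, charFun_apply, integral_map (hsum n) (by fun_prop),
        integral_map (key.forall_aemeasurable _) (by fun_prop)]
      refine integral_congr_ae (.of_forall fun ω => ?_)
      simp [W, hWmean, inner_smul_left, sum_inner]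
    · rw [← hWvar]
      simp [variance_nonneg]

/-- If `X n` converges in distribution and, almost surely, `Y n - X n` is of smaller order
than `X n`, then `Y n` has the same limit in distribution. -/
theorem tendstoInDistribution_of_isLittleO_sub {Ω Ω' E : Type*} [MeasurableSpace Ω]
    [MeasurableSpace Ω'] {P : Measure Ω} [IsProbabilityMeasure P] {P' : Measure Ω'}
    [IsProbabilityMeasure P'] [NormedAddCommGroup E] [NormedSpace ℝ E] [MeasurableSpace E]
    [BorelSpace E] [SecondCountableTopology E] {X Y : ℕ → Ω → E} {Z : Ω' → E}
    (hXZ : TendstoInDistribution X atTop Z (fun _ => P) P') (hY : ∀ n, AEMeasurable (Y n) P)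
    (h : ∀ᵐ ω ∂P, (fun n => Y n ω - X n ω) =o[atTop] fun n => X n ω) :
    TendstoInDistribution Y atTop Z (fun _ => P) P' := by
  have hX := hXZ.forall_aemeasurable
  -- The relative error. Where `X n ω = 0` the inverse is `0` by convention, which is harmless:
  -- there the little-o bound eventually forces `Y n ω = 0` too.
  let V : ℕ → Ω → E := fun n ω => ‖X n ω‖⁻¹ • (Y n ω - X n ω)
  have hV : ∀ n, AEMeasurable (V n) P := fun n =>
    (hX n).norm.inv.smul ((hY n).sub (hX n))
  have hV0 : TendstoInMeasure P V atTop fun _ => 0 := by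
    refine tendstoInMeasure_of_tendsto_ae (fun n => (hV n).aestronglyMeasurable) ?_
    filter_upwards [h] with ω hω
    rw [tendsto_zero_iff_norm_tendsto_zero]
    refine hω.norm_norm.tendsto_div_nhds_zero.congr fun n => ?_
    simp [V, norm_smul, div_eq_inv_mul]
  -- Slutsky for `(x, v) ↦ x + ‖x‖ • v`; almost surely, its value at `(X n, V n)` eventually equals
  -- `Y n`.
  have hg := hXZ.continuous_comp_prodMk_of_tendstoInMeasure_const
    (g := fun x : E × E => x.1 + ‖x.1‖ • x.2) (by fun_prop) hV0 hV
  simp only [smul_zero, add_zero] at hg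
  refine tendstoInDistribution_of_tendstoInMeasure_sub Y Z hg ?_ hY
  refine tendstoInMeasure_of_tendsto_ae (fun n => ?_) ?_
  · exact ((hY n).sub (hg.forall_aemeasurable n)).aestronglyMeasurable
  · filter_upwards [h] with ω hω
    refine tendsto_const_nhds.congr' ?_
    filter_upwards [hω.def one_pos] with n hn
    simp only [Pi.zero_apply, Pi.sub_apply, V]
    rcases eq_or_ne (X n ω) 0 with h0 | h0
    · have : Y n ω = 0 := by simpa [h0] using hn
      simp [h0, this]
    · rw [smul_inv_smul₀ (norm_ne_zero_iff.2 h0)]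
      simp

/-- **Varadarajan's theorem**: empirical distributions converge weakly, almost surely. -/
theorem ae_tendsto_empiricalDistribution {p : ℕ} {Ω : Type*} [MeasurableSpace Ω] {P : Measure Ω}
    [IsProbabilityMeasure P] {G : ProbabilityMeasure (EuclideanSpace ℝ (Fin p))}
    {Z : ℕ → Ω → EuclideanSpace ℝ (Fin p)} (hindep : iIndepFun Z P)
    (hlaw : ∀ i, HasLaw (Z i) (G : Measure (EuclideanSpace ℝ (Fin p))) P) :
    ∀ᵐ ω ∂P, Tendsto (fun n => empiricalDistribution n fun i => Z i ω) atTop (𝓝 G) := by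
  let B := TopologicalSpace.countableBasis (EuclideanSpace ℝ (Fin p))
  -- Finite intersections of basic open sets: a π-system that is still countable, so the strong law
  -- holds on all of its members off one null set. Convergence on it already implies weak
  -- convergence, since it contains a neighbourhood basis of open sets.
  let S : Set (Set (EuclideanSpace ℝ (Fin p))) := (fun f => ⋂₀ f) '' {f | f.Finite ∧ f ⊆ B}
  have hB : TopologicalSpace.IsTopologicalBasis B := TopologicalSpace.isBasis_countableBasis _
  have hScount : S.Countable :=
    (Set.countable_ofPred_finite_subset (TopologicalSpace.countable_countableBasis _)).image _
  have hSopen : ∀ s ∈ S, IsOpen s := by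
    rintro _ ⟨f, ⟨hf, hfB⟩, rfl⟩
    exact hf.isOpen_sInter fun t ht => hB.isOpen (hfB ht)
  have hSpi : IsPiSystem S := by
    rintro _ ⟨f, ⟨hf, hfB⟩, rfl⟩ _ ⟨g, ⟨hg, hgB⟩, rfl⟩ -
    exact ⟨f ∪ g, ⟨hf.union hg, Set.union_subset hfB hgB⟩, Set.sInter_union f g⟩
  have hident : ∀ i, IdentDistrib (Z i) (Z 0) P P := fun i =>
    ⟨(hlaw i).aemeasurable, (hlaw 0).aemeasurable, by rw [(hlaw i).map_eq, (hlaw 0).map_eq]⟩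
  have hS : ∀ s ∈ S, ∀ᵐ ω ∂P,
      Tendsto (fun n => (empiricalDistribution n fun i => Z i ω) s) atTop (𝓝 (G s)) := by
    intro s hs
    have hsm : MeasurableSet s := (hSopen s hs).measurableSet
    have hm : Measurable (s.indicator fun _ => (1 : ℝ)) := measurable_const.indicator hsm
    have hint : Integrable (fun ω => s.indicator (fun _ => (1 : ℝ)) (Z 0 ω)) P :=
      (integrable_const (1 : ℝ)).mono
        (hm.comp_aemeasurable (hlaw 0).aemeasurable).aestronglyMeasurable
        (.of_forall fun ω => norm_indicator_le_norm_self (fun _ => (1 : ℝ)) _)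
    have hlim := strong_law_ae_real (fun i ω => s.indicator (fun _ => (1 : ℝ)) (Z i ω)) hint
      (fun i j hij => (hindep.indepFun hij).comp hm hm) fun i => (hident i).comp hm
    filter_upwards [hlim] with ω hω
    rw [← NNReal.tendsto_coe]
    have hG : ((G s : NNReal) : ℝ) = ∫ ω, s.indicator (fun _ => (1 : ℝ)) (Z 0 ω) ∂P := by
      rw [← Function.comp_def (s.indicator fun _ => (1 : ℝ)),
        (hlaw 0).integral_comp hm.aestronglyMeasurable, integral_indicator_const _ hsm]
      simp [Measure.real]
      rfl
    rw [hG]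
    refine (hω.comp (tendsto_add_atTop_nat 1)).congr fun n => ?_
    rw [Function.comp_apply]
    change _ = (((((n + 1 : ℕ) : ℝ≥0∞)⁻¹ • ∑ i ∈ Finset.range (n + 1),
      Measure.dirac (Z i ω)) s).toNNReal : ℝ)
    simp only [Measure.smul_apply, Measure.finsetSum_apply, smul_eq_mul,
      Measure.dirac_apply' _ hsm]
    rw [ENNReal.coe_toNNReal_eq_toReal, ENNReal.toReal_mul, ENNReal.toReal_sum fun i _ => by
      by_cases hi : Z i ω ∈ s <;> simp [hi]]
    rw [div_eq_inv_mul, ENNReal.toReal_inv, ENNReal.toReal_natCast]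
    congr 1
    refine Finset.sum_congr rfl fun i _ => ?_
    by_cases hi : Z i ω ∈ s <;> simp [hi]
  filter_upwards [(ae_ball_iff hScount).2 hS] with ω hω
  refine hSpi.tendsto_probabilityMeasure_of_tendsto_of_mem
    (fun s hs => (hSopen s hs).measurableSet) (fun u hu x hx => ?_) hω
  obtain ⟨v, hv, hxv, hvu⟩ := hB.exists_subset_of_mem_open hx hu
  exact ⟨v, ⟨{v}, ⟨Set.finite_singleton v, by simpa using hv⟩, by simp⟩,
    (hB.isOpen hv).mem_nhds hxv, hvu⟩

end MFunctional

namespace MFunctional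

/-! ### Measurability, domination and oscillation of the score derivative. -/

section Derivative

variable {p q : ℕ} {Ψ : EuclideanSpace ℝ (Fin p) → EuclideanSpace ℝ (Fin q) →
  EuclideanSpace ℝ (Fin q)}

theorem hasFDerivAt_psiDot (hd : ∀ z, ContDiff ℝ 1 (Ψ z)) (z : EuclideanSpace ℝ (Fin p))
    (θ : EuclideanSpace ℝ (Fin q)) : HasFDerivAt (Ψ z) (psiDot Ψ z θ) θ :=
  ((hd z).differentiable one_ne_zero θ).hasFDerivAt

theorem continuous_psiDot (hd : ∀ z, ContDiff ℝ 1 (Ψ z)) (z : EuclideanSpace ℝ (Fin p)) :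
    Continuous (psiDot Ψ z) :=
  (hd z).continuous_fderiv one_ne_zero

theorem measurable_psiDot (hm : ∀ θ, Measurable fun z => Ψ z θ) (hd : ∀ z, ContDiff ℝ 1 (Ψ z))
    (θ : EuclideanSpace ℝ (Fin q)) : Measurable fun z => psiDot Ψ z θ := by
  have happ : ∀ v, Measurable fun z => psiDot Ψ z θ v := by
    intro v
    -- Each directional derivative is a pointwise limit of difference quotients with step `1 / n`;
    -- the whole derivative is then rebuilt from its columns.
    refine measurable_of_tendsto_metrizable
      (f := fun (n : ℕ) z => (n : ℝ) • (Ψ z (θ + (n : ℝ)⁻¹ • v) - Ψ z θ))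
      (fun n => Measurable.fun_const_smul ((hm _).sub (hm _)) _) ?_
    rw [tendsto_pi_nhds]
    exact fun z => ((hasFDerivAt_psiDot hd z θ).lim_real v).comp tendsto_natCast_atTop_atTop
  have hsum : ∀ z, psiDot Ψ z θ = ∑ i, ContinuousLinearMap.smulRightL ℝ _ _
      (EuclideanSpace.proj (𝕜 := ℝ) i) (psiDot Ψ z θ (EuclideanSpace.single i 1)) := by
    intro z
    ext1 v
    conv_lhs => rw [← (EuclideanSpace.basisFun (Fin q) ℝ).sum_repr v, map_sum]
    simp
  rw [show (fun z => psiDot Ψ z θ) = _ from funext hsum]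
  exact Finset.measurable_fun_sum _ fun i _ =>
    (ContinuousLinearMap.continuous _).measurable.comp (happ _)

/-- By continuity the supremum may be restricted to a countable dense subset of `K`. -/
theorem measurable_biSup_of_continuous {α X : Type*} [MeasurableSpace α]
    [PseudoMetricSpace X] [SecondCountableTopology X] (K : Set X)
    {f : α → X → ℝ≥0∞} (hm : ∀ x, Measurable fun a => f a x) (hc : ∀ a, Continuous (f a)) :
    Measurable fun a => ⨆ x ∈ K, f a x := by
  obtain ⟨S, hS, hSd⟩ := TopologicalSpace.exists_countable_dense K
  have : Countable S := hS
  have h : ∀ a, ⨆ x ∈ K, f a x = ⨆ s : S, f a s := by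
    intro a
    rw [iSup_subtype']
    exact (hSd.ciSup' ((hc a).comp continuous_subtype_val)).symm
  simp_rw [h]
  exact Measurable.iSup fun s => hm _

/-- The envelope of `Ψ̇(z, ·)` on the closed ball of radius `δ` around `θ₀`. -/
noncomputable def psiDotEnvelope (Ψ : EuclideanSpace ℝ (Fin p) → EuclideanSpace ℝ (Fin q) →
    EuclideanSpace ℝ (Fin q)) (θ₀ : EuclideanSpace ℝ (Fin q)) (δ : ℝ)
    (z : EuclideanSpace ℝ (Fin p)) : ℝ≥0∞ :=
  ⨆ θ ∈ Metric.closedBall θ₀ δ, ‖psiDot Ψ z θ‖ₑ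

/-- The oscillation of `Ψ̇(z, ·)` on the closed ball of radius `δ` around `θ₀`. -/
noncomputable def psiDotOsc (Ψ : EuclideanSpace ℝ (Fin p) → EuclideanSpace ℝ (Fin q) →
    EuclideanSpace ℝ (Fin q)) (θ₀ : EuclideanSpace ℝ (Fin q)) (δ : ℝ)
    (z : EuclideanSpace ℝ (Fin p)) : ℝ≥0∞ :=
  ⨆ θ ∈ Metric.closedBall θ₀ δ, ‖psiDot Ψ z θ - psiDot Ψ z θ₀‖ₑ

theorem measurable_psiDotEnvelope (hm : ∀ θ, Measurable fun z => Ψ z θ)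
    (hd : ∀ z, ContDiff ℝ 1 (Ψ z)) (θ₀ : EuclideanSpace ℝ (Fin q)) (δ : ℝ) :
    Measurable (psiDotEnvelope Ψ θ₀ δ) :=
  measurable_biSup_of_continuous _ (fun θ => (measurable_psiDot hm hd θ).enorm)
    fun z => (continuous_psiDot hd z).enorm

theorem measurable_psiDotOsc (hm : ∀ θ, Measurable fun z => Ψ z θ)
    (hd : ∀ z, ContDiff ℝ 1 (Ψ z)) (θ₀ : EuclideanSpace ℝ (Fin q)) (δ : ℝ) :
    Measurable (psiDotOsc Ψ θ₀ δ) :=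
  measurable_biSup_of_continuous _
    (fun θ => ((measurable_psiDot hm hd θ).sub (measurable_psiDot hm hd θ₀)).enorm)
    fun z => ((continuous_psiDot hd z).sub continuous_const).enorm

theorem psiDotOsc_le_envelope (θ₀ : EuclideanSpace ℝ (Fin q)) {δ η : ℝ} (hη : 0 ≤ η)
    (hδ : δ ≤ η) (z : EuclideanSpace ℝ (Fin p)) :
    psiDotOsc Ψ θ₀ δ z ≤ 2 * psiDotEnvelope Ψ θ₀ η z := by
  refine iSup₂_le fun θ hθ => (enorm_sub_le).trans ?_
  rw [two_mul]
  exact add_le_add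
    (le_iSup₂_of_le (f := fun θ _ => ‖psiDot Ψ z θ‖ₑ) θ
      (Metric.closedBall_subset_closedBall hδ hθ) le_rfl)
    (le_iSup₂_of_le (f := fun θ _ => ‖psiDot Ψ z θ‖ₑ) θ₀ (Metric.mem_closedBall_self hη) le_rfl)

/-- Compactness of the ball makes this hold at every `z`, so passing to `toReal` loses nothing, even
off the support of `G₀`. -/
theorem psiDotOsc_lt_top (hd : ∀ z, ContDiff ℝ 1 (Ψ z)) (θ₀ : EuclideanSpace ℝ (Fin q)) (δ : ℝ)
    (z : EuclideanSpace ℝ (Fin p)) : psiDotOsc Ψ θ₀ δ z < ∞ := by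
  obtain ⟨C, hC⟩ := (isCompact_closedBall θ₀ δ).exists_bound_of_continuousOn
    ((continuous_psiDot hd z).sub (continuous_const (y := psiDot Ψ z θ₀))).continuousOn
  refine lt_of_le_of_lt (iSup₂_le fun θ hθ => ?_) (ENNReal.ofReal_lt_top (r := C))
  rw [← ofReal_norm]
  exact ENNReal.ofReal_le_ofReal (hC θ hθ)

theorem norm_psiDot_sub_le (hd : ∀ z, ContDiff ℝ 1 (Ψ z)) {θ₀ θ : EuclideanSpace ℝ (Fin q)}
    {δ : ℝ} (hθ : θ ∈ Metric.closedBall θ₀ δ) (z : EuclideanSpace ℝ (Fin p)) :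
    ‖psiDot Ψ z θ - psiDot Ψ z θ₀‖ ≤ (psiDotOsc Ψ θ₀ δ z).toReal := by
  rw [← toReal_enorm]
  exact ENNReal.toReal_mono (psiDotOsc_lt_top hd θ₀ δ z).ne
    (le_iSup₂_of_le (f := fun θ _ => ‖psiDot Ψ z θ - psiDot Ψ z θ₀‖ₑ) θ hθ le_rfl)

/-- First order expansion of `Ψ(z, ·)` at `θ₀`. -/
theorem norm_sub_sub_psiDot_le (hd : ∀ z, ContDiff ℝ 1 (Ψ z)) {θ₀ θ : EuclideanSpace ℝ (Fin q)}
    {δ : ℝ} (hθ : θ ∈ Metric.closedBall θ₀ δ) (z : EuclideanSpace ℝ (Fin p)) :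
    ‖Ψ z θ - Ψ z θ₀ - psiDot Ψ z θ₀ (θ - θ₀)‖ ≤ (psiDotOsc Ψ θ₀ δ z).toReal * ‖θ - θ₀‖ :=
  (convex_closedBall θ₀ δ).norm_image_sub_le_of_norm_hasFDerivWithin_le'
    (fun _ _ => (hasFDerivAt_psiDot hd z _).hasFDerivWithinAt)
    (fun _ hx => norm_psiDot_sub_le hd hx z)
    (Metric.mem_closedBall_self (dist_nonneg.trans hθ)) hθ

theorem tendsto_psiDotOsc (hd : ∀ z, ContDiff ℝ 1 (Ψ z)) (θ₀ : EuclideanSpace ℝ (Fin q))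
    {δ : ℕ → ℝ} (hδ : Tendsto δ atTop (𝓝 0)) (z : EuclideanSpace ℝ (Fin p)) :
    Tendsto (fun k => psiDotOsc Ψ θ₀ (δ k) z) atTop (𝓝 0) := by
  rw [ENNReal.tendsto_nhds_zero]
  intro ε hε
  have hc : Tendsto (fun θ => ‖psiDot Ψ z θ - psiDot Ψ z θ₀‖ₑ) (𝓝 θ₀) (𝓝 0) := by
    have := ((continuous_psiDot hd z).sub (continuous_const (y := psiDot Ψ z θ₀))).enorm.tendsto θ₀
    rwa [Pi.sub_apply, sub_self, ← ofReal_norm, norm_zero, ENNReal.ofReal_zero] at this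
  obtain ⟨r, hr, hball⟩ := Metric.eventually_nhds_iff.1 (ENNReal.tendsto_nhds_zero.1 hc ε hε)
  filter_upwards [hδ.eventually_lt_const hr] with k hk
  exact iSup₂_le fun θ hθ => hball ((Metric.mem_closedBall.1 hθ).trans_lt hk)

variable {μ : Measure (EuclideanSpace ℝ (Fin p))} {θ₀ : EuclideanSpace ℝ (Fin q)} {η : ℝ}

theorem integrable_psiDot (hm : ∀ θ, Measurable fun z => Ψ z θ) (hd : ∀ z, ContDiff ℝ 1 (Ψ z))
    (hη : 0 < η) (henv : ∫⁻ z, psiDotEnvelope Ψ θ₀ η z ∂μ < ∞) :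
    Integrable (fun z => psiDot Ψ z θ₀) μ :=
  ⟨(measurable_psiDot hm hd θ₀).aestronglyMeasurable, (lintegral_mono fun z =>
    le_iSup₂_of_le (f := fun θ _ => ‖psiDot Ψ z θ‖ₑ) θ₀ (Metric.mem_closedBall_self hη.le)
      le_rfl).trans_lt henv⟩

theorem integrable_psiDotOsc (hm : ∀ θ, Measurable fun z => Ψ z θ)
    (hd : ∀ z, ContDiff ℝ 1 (Ψ z)) (hη : 0 < η)
    (henv : ∫⁻ z, psiDotEnvelope Ψ θ₀ η z ∂μ < ∞) {δ : ℝ} (hδ : δ ≤ η) :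
    Integrable (fun z => (psiDotOsc Ψ θ₀ δ z).toReal) μ := by
  refine integrable_toReal_of_lintegral_ne_top (measurable_psiDotOsc hm hd θ₀ δ).aemeasurable
    (((lintegral_mono (psiDotOsc_le_envelope θ₀ hη.le hδ)).trans_lt ?_).ne)
  rw [lintegral_const_mul _ (measurable_psiDotEnvelope hm hd θ₀ η)]
  exact ENNReal.mul_lt_top (by simp) henv

/-- Dominated convergence, with twice the envelope on the ball of radius `η` as majorant. This takes
the place of any bound on second derivatives of `Ψ`. -/
theorem tendsto_integral_psiDotOsc (hm : ∀ θ, Measurable fun z => Ψ z θ)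
    (hd : ∀ z, ContDiff ℝ 1 (Ψ z)) (hη : 0 < η)
    (henv : ∫⁻ z, psiDotEnvelope Ψ θ₀ η z ∂μ < ∞) {δ : ℕ → ℝ} (hδ : Tendsto δ atTop (𝓝 0))
    (hδη : ∀ k, δ k ≤ η) :
    Tendsto (fun k => ∫ z, (psiDotOsc Ψ θ₀ (δ k) z).toReal ∂μ) atTop (𝓝 0) := by
  have h := tendsto_lintegral_of_dominated_convergence (μ := μ) (f := fun _ => 0)
    (fun z => 2 * psiDotEnvelope Ψ θ₀ η z) (fun k => measurable_psiDotOsc hm hd θ₀ (δ k))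
    (fun k => .of_forall (psiDotOsc_le_envelope θ₀ hη.le (hδη k)))
    (by
      rw [lintegral_const_mul _ (measurable_psiDotEnvelope hm hd θ₀ η)]
      exact ENNReal.mul_ne_top (by simp) henv.ne)
    (.of_forall (tendsto_psiDotOsc hd θ₀ hδ))
  have h' := (ENNReal.tendsto_toReal (by simp)).comp h
  simp only [lintegral_zero, ENNReal.toReal_zero] at h'
  refine h'.congr fun k => ?_
  exact (integral_toReal (measurable_psiDotOsc hm hd θ₀ (δ k)).aemeasurable
    (.of_forall (psiDotOsc_lt_top hd θ₀ (δ k)))).symm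

/-- Differentiation of `θ ↦ E Ψ(z, θ)` under the integral sign. -/
theorem hasFDerivAt_integral_psi (hm : ∀ θ, Measurable fun z => Ψ z θ)
    (hd : ∀ z, ContDiff ℝ 1 (Ψ z)) (hη : 0 < η)
    (henv : ∫⁻ z, psiDotEnvelope Ψ θ₀ η z ∂μ < ∞) (hint : Integrable (fun z => Ψ z θ₀) μ) :
    HasFDerivAt (fun θ => ∫ z, Ψ z θ ∂μ) (∫ z, psiDot Ψ z θ₀ ∂μ) θ₀ := by
  have hme := measurable_psiDotEnvelope hm hd θ₀ η
  refine hasFDerivAt_integral_of_dominated_of_fderiv_le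
    (bound := fun z => (psiDotEnvelope Ψ θ₀ η z).toReal)
    (F' := fun θ z => psiDot Ψ z θ) (Metric.closedBall_mem_nhds θ₀ hη)
    (.of_forall fun θ => (hm θ).aestronglyMeasurable) hint
    (measurable_psiDot hm hd θ₀).aestronglyMeasurable ?_
    (integrable_toReal_of_lintegral_ne_top hme.aemeasurable henv.ne)
    (.of_forall fun z θ _ => hasFDerivAt_psiDot hd z θ)
  filter_upwards [ae_lt_top hme henv.ne] with z hz θ hθ
  rw [← toReal_enorm]
  exact ENNReal.toReal_mono hz.ne
    (le_iSup₂_of_le (f := fun θ _ => ‖psiDot Ψ z θ‖ₑ) θ hθ le_rfl)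

end Derivative

/-! ### Deterministic expansions of approximate zeros. -/

section Expansion

/-- Implicit differentiation of a curve of zeros of `(1 - ε) L + ε g` at the zero of `L`. -/
theorem hasDerivWithinAt_of_isZero_mixture {E : Type*} [NormedAddCommGroup E] [NormedSpace ℝ E]
    {L g : E → E} {θ : ℝ → E} {D : E ≃L[ℝ] E} (hL : HasFDerivAt L (D : E →L[ℝ] E) (θ 0))
    (hL0 : L (θ 0) = 0) (hg : ContinuousAt g (θ 0)) (hθ : Tendsto θ (𝓝[>] 0) (𝓝 (θ 0)))
    (hzero : ∀ᶠ ε in 𝓝[>] (0 : ℝ), (1 - ε) • L (θ ε) + ε • g (θ ε) = 0) :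
    HasDerivWithinAt θ (-D.symm (g (θ 0))) (Set.Icc 0 1) 0 := by
  let w : ℝ → E := fun ε => D.symm (L (θ ε))
  -- The mixture equation solved for `L (θ ε)`; it shows that `w ε / ε` has the claimed derivative
  -- as its limit.
  have ho : w =ᶠ[𝓝[>] 0] fun ε => ε • (-(1 - ε)⁻¹ • D.symm (g (θ ε))) := by
    filter_upwards [hzero, Ioo_mem_nhdsGT one_pos] with ε hε hε1
    have h1 : (1 - ε) ≠ 0 := (sub_pos.2 hε1.2).ne'
    have : L (θ ε) = ε • (-(1 - ε)⁻¹ • g (θ ε)) := by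
      rw [← inv_smul_smul₀ h1 (L (θ ε)), eq_neg_of_add_eq_zero_left hε, smul_neg, smul_smul,
        smul_smul, ← neg_smul]
      ring_nf
    simp only [w, this, map_smul]
  have hlim : Tendsto (fun ε : ℝ => -(1 - ε)⁻¹ • D.symm (g (θ ε))) (𝓝[>] 0)
      (𝓝 (-D.symm (g (θ 0)))) := by
    have h1 : Tendsto (fun ε : ℝ => -(1 - ε)⁻¹) (𝓝[>] 0) (𝓝 (-1)) := by
      have : ContinuousAt (fun ε : ℝ => -(1 - ε)⁻¹) 0 := by fun_prop (disch := norm_num)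
      simpa using this.tendsto.mono_left nhdsWithin_le_nhds
    have h2 := h1.smul ((D.symm.continuous.tendsto _).comp (hg.tendsto.comp hθ))
    simpa using h2
  have hwε : w =O[𝓝[>] 0] fun ε : ℝ => ε := by
    refine ho.trans_isBigO ?_
    have := (Asymptotics.isBigO_refl (fun ε : ℝ => ε) (𝓝[>] 0)).smul (hlim.isBigO_one ℝ)
    simpa using this
  -- Differentiability of `L` gives an error relative to `θ ε - θ 0`. Equivalence is symmetric, so
  -- the error is also small relative to `w`, hence to `ε`.
  have hequiv : Asymptotics.IsEquivalent (𝓝[>] 0) w fun ε => θ ε - θ 0 := by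
    have h1 := (hL.isLittleO.comp_tendsto hθ)
    have h2 := ((D.symm : E →L[ℝ] E).isBigO_comp (fun ε => L (θ ε) - L (θ 0) - D (θ ε - θ 0))
      (𝓝[>] 0)).trans_isLittleO h1
    refine h2.congr_left fun ε => ?_
    simp [w, hL0]
  have hsmall := (hequiv.symm.isLittleO.trans_isBigO hwε).tendsto_inv_smul_nhds_zero
  rw [hasDerivWithinAt_iff_tendsto_slope]
  have hset : Set.Icc (0 : ℝ) 1 \ {0} = Set.Ioc 0 1 := by
    rw [Set.Icc_sdiff_left]
  rw [hset, nhdsWithin_Ioc_eq_nhdsGT one_pos]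
  have := hsmall.add hlim
  rw [zero_add] at this
  refine this.congr' ?_
  filter_upwards [ho, self_mem_nhdsWithin] with ε hε hpos
  have hε0 : ε ≠ 0 := ne_of_gt hpos
  simp only [slope, vsub_eq_sub, sub_zero, Pi.sub_apply]
  rw [smul_sub, hε, inv_smul_smul₀ hε0]
  simp

/-- A pathwise statement: the laws of large numbers enter as hypotheses on one fixed sequence `z`.
-/
theorem isEquivalent_estimator {p q : ℕ} {Ψ : EuclideanSpace ℝ (Fin p) →
    EuclideanSpace ℝ (Fin q) → EuclideanSpace ℝ (Fin q)} (hd : ∀ z, ContDiff ℝ 1 (Ψ z))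
    {θ₀ : EuclideanSpace ℝ (Fin q)} {D : EuclideanSpace ℝ (Fin q) ≃L[ℝ] EuclideanSpace ℝ (Fin q)}
    {z : ℕ → EuclideanSpace ℝ (Fin p)} {θ : ℕ → EuclideanSpace ℝ (Fin q)}
    (hθ : Tendsto θ atTop (𝓝 θ₀))
    (hzero : ∀ᶠ n : ℕ in atTop, ∑ i ∈ Finset.range (n + 1), Ψ (z i) (θ n) = 0)
    (hD : Tendsto (fun n : ℕ => (n : ℝ)⁻¹ • ∑ i ∈ Finset.range n, psiDot Ψ (z i) θ₀) atTop
      (𝓝 (D : EuclideanSpace ℝ (Fin q) →L[ℝ] EuclideanSpace ℝ (Fin q))))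
    {δ : ℕ → ℝ} (hδ : ∀ k, 0 < δ k) {o : ℕ → ℝ} (ho : Tendsto o atTop (𝓝 0))
    (hosc : ∀ k, Tendsto (fun n : ℕ => (n : ℝ)⁻¹ • ∑ i ∈ Finset.range n,
      (psiDotOsc Ψ θ₀ (δ k) (z i)).toReal) atTop (𝓝 (o k))) :
    Asymptotics.IsEquivalent atTop (fun n => θ n - θ₀) fun n : ℕ =>
      ((n + 1 : ℕ) : ℝ)⁻¹ • ∑ i ∈ Finset.range (n + 1), -D.symm (Ψ (z i) θ₀) := by
  let S : ℕ → EuclideanSpace ℝ (Fin q) := fun n =>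
    ((n + 1 : ℕ) : ℝ)⁻¹ • ∑ i ∈ Finset.range (n + 1), Ψ (z i) θ₀
  have hmain : (fun n => -S n - D (θ n - θ₀)) =o[atTop] fun n => θ n - θ₀ := by
    refine Asymptotics.IsLittleO.of_bound fun c hc => ?_
    -- Half of `c` covers the Taylor error on the ball of radius `δ k`, the other half the
    -- replacement of the empirical derivative `A` by `D`.
    obtain ⟨k, hk⟩ := (ho.eventually_lt_const (half_pos hc)).exists
    filter_upwards [hzero,
      ((hosc k).comp (tendsto_add_atTop_nat 1)).eventually_lt_const hk,
      Metric.tendsto_nhds.1 (hD.comp (tendsto_add_atTop_nat 1)) _ (half_pos hc),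
      hθ.eventually (Metric.closedBall_mem_nhds θ₀ (hδ k))] with n h1 h2 h3 h4
    simp only [Function.comp_apply, smul_eq_mul, dist_eq_norm] at h2 h3
    have hinv : (0 : ℝ) ≤ ((n + 1 : ℕ) : ℝ)⁻¹ := by positivity
    set A := ((n + 1 : ℕ) : ℝ)⁻¹ • ∑ i ∈ Finset.range (n + 1), psiDot Ψ (z i) θ₀ with hA
    have h5 : ‖-S n - A (θ n - θ₀)‖ ≤ c / 2 * ‖θ n - θ₀‖ := by
      have : -S n - A (θ n - θ₀) = ((n + 1 : ℕ) : ℝ)⁻¹ • ∑ i ∈ Finset.range (n + 1),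
          (Ψ (z i) (θ n) - Ψ (z i) θ₀ - psiDot Ψ (z i) θ₀ (θ n - θ₀)) := by
        rw [Finset.sum_sub_distrib, Finset.sum_sub_distrib, h1, zero_sub, smul_sub, smul_neg]
        simp only [S, hA, smul_apply, sum_apply]
      rw [this, norm_smul, Real.norm_of_nonneg hinv]
      calc _ ≤ ((n + 1 : ℕ) : ℝ)⁻¹ * ∑ i ∈ Finset.range (n + 1),
            (psiDotOsc Ψ θ₀ (δ k) (z i)).toReal * ‖θ n - θ₀‖ :=
            mul_le_mul_of_nonneg_left
              (norm_sum_le_of_le _ fun i _ => norm_sub_sub_psiDot_le hd h4 (z i)) hinv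
        _ = (((n + 1 : ℕ) : ℝ)⁻¹ * ∑ i ∈ Finset.range (n + 1),
            (psiDotOsc Ψ θ₀ (δ k) (z i)).toReal) * ‖θ n - θ₀‖ := by
            rw [← Finset.sum_mul, mul_assoc]
        _ ≤ c / 2 * ‖θ n - θ₀‖ := mul_le_mul_of_nonneg_right h2.le (norm_nonneg _)
    have h6 : ‖(A - (D : EuclideanSpace ℝ (Fin q) →L[ℝ] EuclideanSpace ℝ (Fin q))) (θ n - θ₀)‖ ≤
        c / 2 * ‖θ n - θ₀‖ :=
      ((A - (D : EuclideanSpace ℝ (Fin q) →L[ℝ] EuclideanSpace ℝ (Fin q))).le_opNorm _).trans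
        (mul_le_mul_of_nonneg_right h3.le (norm_nonneg _))
    have h7 : -S n - D (θ n - θ₀) = (-S n - A (θ n - θ₀)) +
        (A - (D : EuclideanSpace ℝ (Fin q) →L[ℝ] EuclideanSpace ℝ (Fin q))) (θ n - θ₀) := by
      simp
    rw [h7]
    linarith [norm_add_le (-S n - A (θ n - θ₀))
      ((A - (D : EuclideanSpace ℝ (Fin q) →L[ℝ] EuclideanSpace ℝ (Fin q))) (θ n - θ₀))]
  have h := ((D.symm : EuclideanSpace ℝ (Fin q) →L[ℝ] EuclideanSpace ℝ (Fin q)).isBigO_comp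
    (fun n => -S n - D (θ n - θ₀)) atTop).trans_isLittleO hmain
  refine Asymptotics.IsEquivalent.symm (h.congr_left fun n => ?_)
  simp [S, map_sum]

end Expansion

end MFunctional

/-! ### M functionals at contaminated and empirical distributions. -/

namespace MFunctional

theorem coe_contaminationPath {p : ℕ} (G : ProbabilityMeasure (EuclideanSpace ℝ (Fin p)))
    (z : EuclideanSpace ℝ (Fin p)) {ε : ℝ} (hε : ε ∈ Set.Icc (0 : ℝ) 1) :
    (contaminationPath G z ε : Measure (EuclideanSpace ℝ (Fin p))) =
      ENNReal.ofReal (1 - ε) • (G : Measure (EuclideanSpace ℝ (Fin p))) +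
        ENNReal.ofReal ε • Measure.dirac z := by
  rw [contaminationPath, Set.projIcc_of_mem _ hε]
  rfl

theorem contaminationPath_zero {p : ℕ} (G : ProbabilityMeasure (EuclideanSpace ℝ (Fin p)))
    (z : EuclideanSpace ℝ (Fin p)) : contaminationPath G z 0 = G := by
  apply Subtype.ext
  change (contaminationPath G z 0 : Measure (EuclideanSpace ℝ (Fin p))) = _
  rw [coe_contaminationPath G z ⟨le_rfl, zero_le_one⟩]
  simp

theorem integral_contaminationPath {p : ℕ} {E : Type*} [NormedAddCommGroup E] [NormedSpace ℝ E]
    [CompleteSpace E] (G : ProbabilityMeasure (EuclideanSpace ℝ (Fin p)))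
    (z : EuclideanSpace ℝ (Fin p)) {ε : ℝ} (hε : ε ∈ Set.Icc (0 : ℝ) 1)
    {f : EuclideanSpace ℝ (Fin p) → E}
    (hf : Integrable f (contaminationPath G z ε : Measure (EuclideanSpace ℝ (Fin p)))) :
    ∫ x, f x ∂(contaminationPath G z ε : Measure (EuclideanSpace ℝ (Fin p))) =
      (1 - ε) • ∫ x, f x ∂(G : Measure (EuclideanSpace ℝ (Fin p))) + ε • f z := by
  rw [coe_contaminationPath G z hε] at hf ⊢
  rw [integrable_add_measure] at hf
  rw [integral_add_measure hf.1 hf.2, integral_smul_measure, integral_smul_measure,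
    integral_dirac, ENNReal.toReal_ofReal (sub_nonneg.2 hε.2), ENNReal.toReal_ofReal hε.1]

/-- Integrals of bounded continuous functions are affine in `ε` along the path. -/
theorem tendsto_contaminationPath {p : ℕ} (G : ProbabilityMeasure (EuclideanSpace ℝ (Fin p)))
    (z : EuclideanSpace ℝ (Fin p)) :
    Tendsto (contaminationPath G z) (𝓝[>] 0) (𝓝 G) := by
  rw [ProbabilityMeasure.tendsto_iff_forall_integral_tendsto]
  intro f
  have h : Tendsto (fun ε : ℝ =>
      (1 - ε) • ∫ x, f x ∂(G : Measure (EuclideanSpace ℝ (Fin p))) + ε • f z) (𝓝[>] 0)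
      (𝓝 (∫ x, f x ∂(G : Measure (EuclideanSpace ℝ (Fin p))))) := by
    refine (Continuous.tendsto' (by fun_prop) _ _ ?_).mono_left nhdsWithin_le_nhds
    simp
  refine h.congr' ?_
  filter_upwards [Ioo_mem_nhdsGT one_pos] with ε hε
  exact (integral_contaminationPath G z ⟨hε.1.le, hε.2.le⟩ (f.integrable _)).symm

theorem integral_empiricalDistribution {p : ℕ} {E : Type*} [NormedAddCommGroup E]
    [NormedSpace ℝ E] [CompleteSpace E] (n : ℕ) (z : ℕ → EuclideanSpace ℝ (Fin p))
    (f : EuclideanSpace ℝ (Fin p) → E) :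
    ∫ x, f x ∂(empiricalDistribution n z : Measure (EuclideanSpace ℝ (Fin p))) =
      ((n + 1 : ℕ) : ℝ)⁻¹ • ∑ i ∈ Finset.range (n + 1), f (z i) := by
  change ∫ x, f x ∂(((n + 1 : ℕ) : ℝ≥0∞)⁻¹ • ∑ i ∈ Finset.range (n + 1), Measure.dirac (z i)) = _
  rw [integral_smul_measure, integral_finsetSum_measure fun i _ =>
    integrable_dirac (by simp), ENNReal.toReal_inv, ENNReal.toReal_natCast]
  simp only [integral_dirac]

section MFunctional

variable {p q : ℕ} {Ψ : EuclideanSpace ℝ (Fin p) → EuclideanSpace ℝ (Fin q) →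
  EuclideanSpace ℝ (Fin q)} {dom : Set (ProbabilityMeasure (EuclideanSpace ℝ (Fin p)))}
  {T : ProbabilityMeasure (EuclideanSpace ℝ (Fin p)) → EuclideanSpace ℝ (Fin q)}
  {G₀ : ProbabilityMeasure (EuclideanSpace ℝ (Fin p))}
  {D : EuclideanSpace ℝ (Fin q) ≃L[ℝ] EuclideanSpace ℝ (Fin q)} {η : ℝ}

theorem hasDerivWithinAt_contaminationPath (hm : ∀ θ, Measurable fun z => Ψ z θ)
    (hd : ∀ z, ContDiff ℝ 1 (Ψ z)) (hT : IsMFunctional Ψ dom T) (hG₀ : G₀ ∈ dom)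
    (hTc : ContinuousWithinAt T dom G₀) (hη : 0 < η)
    (henv : ∫⁻ z, psiDotEnvelope Ψ (T G₀) η z ∂(G₀ : Measure (EuclideanSpace ℝ (Fin p))) < ∞)
    (hD : (D : EuclideanSpace ℝ (Fin q) →L[ℝ] EuclideanSpace ℝ (Fin q)) =
      meanPsiDot Ψ G₀ (T G₀))
    (z : EuclideanSpace ℝ (Fin p))
    (hz : ∀ᶠ ε in 𝓝[>] (0 : ℝ), contaminationPath G₀ z ε ∈ dom) :
    HasDerivWithinAt (fun ε : ℝ => T (contaminationPath G₀ z ε)) (-D.symm (Ψ z (T G₀)))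
      (Set.Icc 0 1) 0 := by
  have h := hasDerivWithinAt_of_isZero_mixture
    (L := fun θ => ∫ x, Ψ x θ ∂(G₀ : Measure (EuclideanSpace ℝ (Fin p)))) (g := Ψ z)
    (θ := fun ε : ℝ => T (contaminationPath G₀ z ε)) (D := D)
  simp only [contaminationPath_zero] at h
  refine h ?_ (hT.integral_eq_zero _ hG₀) (hd z).continuous.continuousAt ?_ ?_
  · rw [hD]
    exact hasFDerivAt_integral_psi hm hd hη henv (hT.integrable _ hG₀)
  · exact hTc.tendsto.comp (tendsto_nhdsWithin_iff.2 ⟨tendsto_contaminationPath G₀ z, hz⟩)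
  · filter_upwards [hz, Ioo_mem_nhdsGT one_pos] with ε hε hε1
    rw [← integral_contaminationPath G₀ z ⟨hε1.1.le, hε1.2.le⟩ (hT.integrable _ hε)]
    exact hT.integral_eq_zero _ hε

theorem influenceFunction_eq (hm : ∀ θ, Measurable fun z => Ψ z θ)
    (hd : ∀ z, ContDiff ℝ 1 (Ψ z)) (hT : IsMFunctional Ψ dom T) (hG₀ : G₀ ∈ dom)
    (hTc : ContinuousWithinAt T dom G₀) (hη : 0 < η)
    (henv : ∫⁻ z, psiDotEnvelope Ψ (T G₀) η z ∂(G₀ : Measure (EuclideanSpace ℝ (Fin p))) < ∞)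
    (hD : (D : EuclideanSpace ℝ (Fin q) →L[ℝ] EuclideanSpace ℝ (Fin q)) =
      meanPsiDot Ψ G₀ (T G₀))
    (z : EuclideanSpace ℝ (Fin p))
    (hz : ∀ᶠ ε in 𝓝[>] (0 : ℝ), contaminationPath G₀ z ε ∈ dom) :
    influenceFunction T G₀ z = -D.symm (Ψ z (T G₀)) :=
  (hasDerivWithinAt_contaminationPath hm hd hT hG₀ hTc hη henv hD z hz).derivWithin
    (uniqueDiffOn_Icc zero_lt_one 0 ⟨le_rfl, zero_le_one⟩)

/-- Almost surely, `T(G_n) - T(G₀)` is equivalent to the mean of `-D⁻¹ Ψ(z_i, T(G₀))`. -/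
theorem ae_isEquivalent_estimator {Ω : Type*} [MeasurableSpace Ω] {P : Measure Ω}
    [IsProbabilityMeasure P] (hm : ∀ θ, Measurable fun z => Ψ z θ)
    (hd : ∀ z, ContDiff ℝ 1 (Ψ z)) (hT : IsMFunctional Ψ dom T)
    (hTc : ContinuousWithinAt T dom G₀) (hη : 0 < η)
    (henv : ∫⁻ z, psiDotEnvelope Ψ (T G₀) η z ∂(G₀ : Measure (EuclideanSpace ℝ (Fin p))) < ∞)
    (hD : (D : EuclideanSpace ℝ (Fin q) →L[ℝ] EuclideanSpace ℝ (Fin q)) =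
      meanPsiDot Ψ G₀ (T G₀))
    {Z : ℕ → Ω → EuclideanSpace ℝ (Fin p)} (hindep : iIndepFun Z P)
    (hlaw : ∀ i, HasLaw (Z i) (G₀ : Measure (EuclideanSpace ℝ (Fin p))) P)
    (hdom : ∀ᵐ ω ∂P, ∀ᶠ n : ℕ in atTop, empiricalDistribution n (fun i => Z i ω) ∈ dom) :
    ∀ᵐ ω ∂P, Asymptotics.IsEquivalent atTop
      (fun n => T (empiricalDistribution n fun i => Z i ω) - T G₀) fun n : ℕ =>
        ((n + 1 : ℕ) : ℝ)⁻¹ • ∑ i ∈ Finset.range (n + 1), -D.symm (Ψ (Z i ω) (T G₀)) := by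
  have hident : ∀ i, IdentDistrib (Z i) (Z 0) P P := fun i =>
    ⟨(hlaw i).aemeasurable, (hlaw 0).aemeasurable, by rw [(hlaw i).map_eq, (hlaw 0).map_eq]⟩
  have hmD := measurable_psiDot hm hd (T G₀)
  have hintD := integrable_psiDot hm hd hη henv
  have hlimD := strong_law_ae (fun i ω => psiDot Ψ (Z i ω) (T G₀))
    (((hlaw 0).map_eq ▸ hintD :
      Integrable (fun z => psiDot Ψ z (T G₀)) (P.map (Z 0))).comp_aemeasurable
        (hlaw 0).aemeasurable)
    (fun i j hij => (hindep.indepFun hij).comp hmD hmD) fun i => (hident i).comp hmD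
  have hmeanD : ∫ ω, psiDot Ψ (Z 0 ω) (T G₀) ∂P = D := by
    rw [hD, meanPsiDot, ← (hlaw 0).integral_comp hmD.aestronglyMeasurable]
    rfl
  -- Countably many radii suffice, so the strong laws hold for all of them off a single null set.
  let δ : ℕ → ℝ := fun k => η / (k + 1)
  have hδpos : ∀ k, 0 < δ k := fun k => by positivity
  have hδη : ∀ k, δ k ≤ η := fun k => div_le_self hη.le (by simp)
  have hδ : Tendsto δ atTop (𝓝 0) := by
    have := (tendsto_one_div_add_atTop_nhds_zero_nat (𝕜 := ℝ)).const_mul η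
    simpa [δ, div_eq_mul_inv] using this
  have hmO : ∀ k, Measurable fun z => (psiDotOsc Ψ (T G₀) (δ k) z).toReal := fun k =>
    (measurable_psiDotOsc hm hd (T G₀) (δ k)).ennreal_toReal
  have hlimO : ∀ᵐ ω ∂P, ∀ k, Tendsto (fun n : ℕ => (n : ℝ)⁻¹ • ∑ i ∈ Finset.range n,
      (psiDotOsc Ψ (T G₀) (δ k) (Z i ω)).toReal) atTop
      (𝓝 (∫ z, (psiDotOsc Ψ (T G₀) (δ k) z).toReal
        ∂(G₀ : Measure (EuclideanSpace ℝ (Fin p))))) := by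
    refine ae_all_iff.2 fun k => ?_
    have hint := integrable_psiDotOsc hm hd hη henv (hδη k)
    have h := strong_law_ae (fun i ω => (psiDotOsc Ψ (T G₀) (δ k) (Z i ω)).toReal)
      (((hlaw 0).map_eq ▸ hint : Integrable (fun z => (psiDotOsc Ψ (T G₀) (δ k) z).toReal)
        (P.map (Z 0))).comp_aemeasurable (hlaw 0).aemeasurable)
      (fun i j hij => (hindep.indepFun hij).comp (hmO k) (hmO k)) fun i => (hident i).comp (hmO k)
    rw [← (hlaw 0).integral_comp (hmO k).aestronglyMeasurable]
    exact h
  filter_upwards [hdom, ae_tendsto_empiricalDistribution hindep hlaw, hlimD, hlimO]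
    with ω h1 h2 h3 h4
  rw [hmeanD] at h3
  refine isEquivalent_estimator hd
    (hTc.tendsto.comp (tendsto_nhdsWithin_iff.2 ⟨h2, h1⟩)) ?_ h3 hδpos
    (tendsto_integral_psiDotOsc hm hd hη henv hδ hδη) h4
  filter_upwards [h1] with n hn
  have h5 := hT.integral_eq_zero _ hn
  rw [integral_empiricalDistribution] at h5
  exact (smul_eq_zero.1 h5).resolve_left (inv_ne_zero (Nat.cast_ne_zero.2 n.succ_ne_zero))

end MFunctional

end MFunctional

/-! ### Existence of the influence function and asymptotic normality. -/

theorem corollary2 {p q : ℕ} {Ω : Type*} [MeasurableSpace Ω] (P : Measure Ω)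
    [IsProbabilityMeasure P]
    (Ψ : EuclideanSpace ℝ (Fin p) → EuclideanSpace ℝ (Fin q) → EuclideanSpace ℝ (Fin q))
    (hΨ_meas : ∀ θ, Measurable fun z => Ψ z θ)
    (hΨ_diff : ∀ z, ContDiff ℝ 1 (Ψ z))
    (dom : Set (ProbabilityMeasure (EuclideanSpace ℝ (Fin p))))
    (T : ProbabilityMeasure (EuclideanSpace ℝ (Fin p)) → EuclideanSpace ℝ (Fin q))
    (hT : MFunctional.IsMFunctional Ψ dom T)
    (G₀ : ProbabilityMeasure (EuclideanSpace ℝ (Fin p))) (hG₀ : G₀ ∈ dom)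
    (hT_cont : ContinuousWithinAt T dom G₀)
    (hΨ_env : ∃ η : ℝ, 0 < η ∧
      ∫⁻ z, ⨆ θ ∈ Metric.closedBall (T G₀) η, ‖MFunctional.psiDot Ψ z θ‖ₑ
        ∂(G₀ : Measure (EuclideanSpace ℝ (Fin p))) < ∞)
    (hD₀ : (MFunctional.meanPsiDot Ψ G₀ (T G₀)).det ≠ 0)
    (hI_dom : ∀ᵐ z ∂(G₀ : Measure (EuclideanSpace ℝ (Fin p))),
      ∀ᶠ ε in 𝓝[>] (0 : ℝ), MFunctional.contaminationPath G₀ z ε ∈ dom)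
    (hI_moment : MemLp (MFunctional.influenceFunction T G₀) 2
      (G₀ : Measure (EuclideanSpace ℝ (Fin p))))
    (Z : ℕ → Ω → EuclideanSpace ℝ (Fin p))
    (hZ_indep : iIndepFun Z P)
    (hZ_law : ∀ i, HasLaw (Z i) (G₀ : Measure (EuclideanSpace ℝ (Fin p))) P)
    (hG_dom : ∀ᵐ ω ∂P, ∀ᶠ n : ℕ in atTop,
      MFunctional.empiricalDistribution n (fun i => Z i ω) ∈ dom)
    (hT_meas : ∀ n : ℕ,
      AEMeasurable (fun ω => T (MFunctional.empiricalDistribution n fun i => Z i ω)) P) :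
    (∀ z, (∀ᶠ ε in 𝓝[>] (0 : ℝ), MFunctional.contaminationPath G₀ z ε ∈ dom) →
      HasDerivWithinAt (fun ε : ℝ => T (MFunctional.contaminationPath G₀ z ε))
        (MFunctional.influenceFunction T G₀ z) (Set.Icc 0 1) 0) ∧
    TendstoInDistribution
      (fun (n : ℕ) ω => √((n + 1 : ℕ) : ℝ) •
        (T (MFunctional.empiricalDistribution n fun i => Z i ω) - T G₀))
      atTop id (fun _ => P)
      (multivariateGaussian 0 (MFunctional.asymptoticCovariance T G₀)) := by
  obtain ⟨η, hη, henv⟩ := hΨ_env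
  let D := (MFunctional.meanPsiDot Ψ G₀ (T G₀)).toContinuousLinearEquivOfDetNeZero hD₀
  have hD : (D : EuclideanSpace ℝ (Fin q) →L[ℝ] EuclideanSpace ℝ (Fin q)) =
      MFunctional.meanPsiDot Ψ G₀ (T G₀) :=
    ContinuousLinearMap.coe_toContinuousLinearEquivOfDetNeZero _ hD₀
  have hIF := MFunctional.influenceFunction_eq hΨ_meas hΨ_diff hT hG₀ hT_cont hη henv hD
  refine ⟨fun z hz => ?_, ?_⟩
  · rw [hIF z hz]
    exact MFunctional.hasDerivWithinAt_contaminationPath hΨ_meas hΨ_diff hT hG₀ hT_cont hη henv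
      hD z hz
  let φ : EuclideanSpace ℝ (Fin p) → EuclideanSpace ℝ (Fin q) := fun z => -D.symm (Ψ z (T G₀))
  have hφm : Measurable φ := (D.symm.continuous.measurable.comp (hΨ_meas (T G₀))).neg
  have hφ : MFunctional.influenceFunction T G₀
      =ᵐ[(G₀ : Measure (EuclideanSpace ℝ (Fin p)))] φ := hI_dom.mono hIF
  have hident : ∀ i, IdentDistrib (Z i) (Z 0) P P := fun i =>
    ⟨(hZ_law i).aemeasurable, (hZ_law 0).aemeasurable, by
      rw [(hZ_law i).map_eq, (hZ_law 0).map_eq]⟩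
  -- Square integrability is assumed for the influence function; it passes to `φ` because the two
  -- agree almost everywhere.
  have hmom : MemLp (fun ω => φ (Z 0 ω)) 2 P := by
    have h := hI_moment.ae_eq hφ
    rw [← (hZ_law 0).map_eq] at h
    exact h.comp_of_map (hZ_law 0).aemeasurable
  have hmean : ∫ ω, φ (Z 0 ω) ∂P = 0 := by
    rw [← Function.comp_def φ, (hZ_law 0).integral_comp hφm.aestronglyMeasurable, integral_neg,
      D.symm.integral_comp_comm, hT.integral_eq_zero _ hG₀, map_zero, neg_zero]
  have hcov : MFunctional.asymptoticCovariance T G₀ =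
      Matrix.of fun j k => ∫ ω, φ (Z 0 ω) j * φ (Z 0 ω) k ∂P := by
    ext j k
    simp only [MFunctional.asymptoticCovariance, Matrix.of_apply]
    have h := (hZ_law 0).integral_comp (f := fun z => φ z j * φ z k)
      (by fun_prop : Measurable fun z => φ z j * φ z k).aestronglyMeasurable
    rw [Function.comp_def] at h
    rw [h]
    exact integral_congr_ae (hφ.mono fun z hz => by simp only [hz])
  rw [hcov]
  have hclt := MFunctional.tendstoInDistribution_inv_sqrt_smul_sum
    (X := fun i ω => φ (Z i ω)) hmom hmean (hZ_indep.comp (fun _ => φ) fun _ => hφm)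
    fun i => (hident i).comp hφm
  refine MFunctional.tendstoInDistribution_of_isLittleO_sub hclt (fun n => ?_) ?_
  · exact ((hT_meas n).sub_const _).fun_const_smul _
  · filter_upwards [MFunctional.ae_isEquivalent_estimator hΨ_meas hΨ_diff hT hT_cont hη henv hD
      hZ_indep hZ_law hG_dom] with ω hω
    -- Scaling the equivalence by `√(n + 1)` turns the mean into the normalised sum of the central
    -- limit theorem.
    have h := (Asymptotics.isBigO_refl (fun n : ℕ => √((n + 1 : ℕ) : ℝ)) atTop).smul_isLittleO
      hω.isLittleO
    have hsqrt : ∀ n : ℕ, √((n + 1 : ℕ) : ℝ) * ((n + 1 : ℕ) : ℝ)⁻¹ = (√((n + 1 : ℕ) : ℝ))⁻¹ :=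
      fun n => by rw [← div_eq_mul_inv, Real.sqrt_div_self]
    refine (h.congr_left fun n => ?_).congr_right fun n => ?_
    · simp only [Pi.sub_apply, smul_sub, smul_smul, hsqrt, φ]
    · simp only [smul_smul, hsqrt, φ]
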